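/- Let $\mathcal A$ be a unital C$^*$-algebra, $\mathcal D=\{z\in\mathcal A:\|z\|<1\}$, and regard $\mathcal A^2$ (column vectors) as a right $\mathcal A$-module with the form $\theta(\mathbf x,\mathbf y)=x_1^*y_1-x_2^*y_2$. For $z\in\mathcal D$ put $\ell_z=\{\binom{1}{z}a:a\in\mathcal A\}$ and $|z|=(z^*z)^{1/2}$, and let $cr(0,z)$ be the module endomorphism of $\ell_z$ given by $$cr(0,z)\Big(\tbinom{1}{z}a\Big)=\tbinom{1}{z}(1+|z|)(1-|z|)^{-1}a .$$ For $v\in\mathcal A$ write $\hat v=\begin{pmatrix}0&v^*\\ v&0\end{pmatrix}$. A matrix $g$ acts on points by $g\cdot z=(g_{21}+g_{22}z)(g_{11}+g_{12}z)^{-1}$, and $\mathrm{Exp}_0(v)=e^{\hat v}\cdot 0$ is the value at time $1$ of the geodesic $t\mapsto e^{t\hat v}\cdot 0$ of $\mathcal D$ with initial velocity $v\in(T\mathcal D)_0=\mathcal A$. A point $z\in\mathcal D$ is identified with the reflection $\epsilon_z=2q_z-1\in M_2(\mathcal A)$, where $q_z$ is the $\theta$-orthogonal projection onto $\ell_z$,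 and a vector $v\in(T\mathcal D)_0$ with the matrix $X_v=\frac{d}{dt}\big|_{t=0}\,\epsilon_{tv}$. Put $\langle v,w\rangle_0=-\theta(X_v\mathbf e_1,X_w\mathbf e_1)$, where $\mathbf e_1=\binom10$ (this is the coefficient, in the basis $\mathbf e_1$, of an endomorphism of $\ell_0$), and $mod_0(v)=\langle v,v\rangle_0^{1/2}$. **Theorem.** Let $z\in\mathcal D$. There is exactly one $v\in\mathcal A$ with $\mathrm{Exp}_0(v)=z$; denote it by $\mathrm{Log}_0(z)$. Put $\alpha=z\sum_{k\ge 0}\frac{1}{2k+1}(z^*z)^k$. Then $e^{\hat\alpha}$ maps $\ell_0$ isomorphically onto $\ell_z$, with inverse the restriction of $e^{-\hat\alpha}$, and the parallel transport $$cr(0,z)_0:=e^{-\hat\alpha}\,cr(0,z)\,e^{\hat\alpha}:\ell_0\to\ell_0$$ of $cr(0,z)$ along the geodesic from $0$ to $z$ satisfies $$e^{mod_0(\mathrm{Log}_0(z))}=cr(0,z)_0\qquad\text{and, equivalently,}\qquad mod_0(\mathrm{Log}_0(z))=\log\big(cr(0,z)_0\big),$$ where each endomorphism $\varphi$ of $\ell_0$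 is identified with its coefficient $a\in\mathcal A$ in the basis $\mathbf e_1$, $\varphi(\mathbf e_1)=\mathbf e_1a$. -/

import Mathlib

open scoped Matrix

namespace OperatorDisk

noncomputable section

/-- The form `θ(x, y) = x₁* y₁ - x₂* y₂` on `A²`. -/
def theta {A : Type*} [CStarAlgebra A] (x y : Fin 2 → A) : A :=
  star (x 0) * y 0 - star (x 1) * y 1

/-- The generator `(1, z)` of the line attached to the point `z` of the disk; `gen 0 = e₁`. -/
def gen {A : Type*} [CStarAlgebra A] (z : A) : Fin 2 → A := ![1, z]

/-- The rank one right `A`-submodule `ℓ_z = {(1, z) a : a ∈ A}` of `A²`.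
Right `A`-modules are modules over `Aᵐᵒᵖ`. -/
def line {A : Type*} [CStarAlgebra A] (z : A) : Submodule Aᵐᵒᵖ (Fin 2 → A) :=
  Submodule.span Aᵐᵒᵖ {gen z}

theorem gen_mem_line {A : Type*} [CStarAlgebra A] (z : A) : gen z ∈ line z :=
  Submodule.mem_span_singleton_self _

/-- Sanity check: `ℓ_z` consists of the multiples `(1, z) a = (a, z a)`. -/
theorem mem_line_iff {A : Type*} [CStarAlgebra A] (z : A) (x : Fin 2 → A) :
    x ∈ line z ↔ ∃ a : A, x = ![a, z * a] := by
  unfold line gen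
  rw [Submodule.mem_span_singleton]
  constructor
  · rintro ⟨a, rfl⟩
    refine ⟨a.unop, ?_⟩
    ext i
    fin_cases i <;> simp
  · rintro ⟨a, rfl⟩
    refine ⟨MulOpposite.op a, ?_⟩
    ext i
    fin_cases i <;> simp

/-- The matrix `[[0, a*], [a, 0]]`. -/
def hat {A : Type*} [CStarAlgebra A] (a : A) : Matrix (Fin 2) (Fin 2) A :=
  !![0, star a; a, 0]

/-- The action `g · z = (g₂₁ + g₂₂ z)(g₁₁ + g₁₂ z)⁻¹` of `2 × 2` matrices on points. -/
def moebius {A : Type*} [CStarAlgebra A] (g : Matrix (Fin 2) (Fin 2) A) (z : A) : A :=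
  (g 1 0 + g 1 1 * z) * Ring.inverse (g 0 0 + g 0 1 * z)

/-- The exponential map of the disk at the origin: the value at time `1` of the geodesic
`t ↦ exp (t [[0, a*], [a, 0]]) · 0`, which starts at `0` with velocity `a`. -/
def expZero {A : Type*} [CStarAlgebra A] (a : A) : A :=
  moebius (NormedSpace.exp (hat a)) 0

/-- The logarithm map of the disk at the origin: the inverse of `expZero`. -/
def logZero {A : Type*} [CStarAlgebra A] (z : A) : A :=
  Function.invFun expZero z

/-- The element `α = z ∑ₖ (z* z)ᵏ / (2k+1)`. -/
def alpha {A : Type*} [CStarAlgebra A] (z : A) : A :=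
  z * ∑' k : ℕ, (1 / (2 * (k : ℝ) + 1)) • (star z * z) ^ k

/-- The matrix of the `θ`-orthogonal projection `y ↦ x θ(x, x)⁻¹ θ(x, y)` onto the line
generated by `x`. For `θ(x, x) = 1` this is `x θ(x, ·)`. -/
def thetaProj {A : Type*} [CStarAlgebra A] (x : Fin 2 → A) : Matrix (Fin 2) (Fin 2) A :=
  Matrix.of fun i j => x i * Ring.inverse (theta x x) * theta x (Pi.single j 1)

/-- The point `ε_z = 2 q_z - 1` of the space of reflections
`Q_ρ = {ε : ε² = 1, ρ ε positive and invertible}` that corresponds to the point `z` of the disk;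
`q_z` is the `θ`-orthogonal projection onto `ℓ_z`. -/
def reflection {A : Type*} [CStarAlgebra A] (z : A) : Matrix (Fin 2) (Fin 2) A :=
  (2 : ℝ) • thetaProj (gen z) - 1

/-- The tangent vector of `Q_ρ` at `ε_0` that corresponds to the tangent vector `v` of the disk
at `0`: the (entrywise) derivative of `z ↦ ε_z` at `0` in the direction `v`. -/
def tangentZero {A : Type*} [CStarAlgebra A] (v : A) : Matrix (Fin 2) (Fin 2) A :=
  Matrix.of fun i j => deriv (fun t : ℝ => reflection (t • v) i j) 0

/-- The inner product `⟨X, Y⟩ₓ = -θ(X x, Y x)` of tangent vectors of `Q_ρ`, written as the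
coefficient of an endomorphism of the line generated by `x` in the basis `x`. -/
def innerAt {A : Type*} [CStarAlgebra A] (x : Fin 2 → A) (X Y : Matrix (Fin 2) (Fin 2) A) : A :=
  -theta (X *ᵥ x) (Y *ᵥ x)

/-- The `θ`-modulus `⟨v, v⟩₀^{1/2}` of a tangent vector `v` of the disk at `0`, as a coefficient
in the basis `e₁` of `ℓ_0`. -/
def modZero {A : Type*} [CStarAlgebra A] [PartialOrder A] [StarOrderedRing A] (v : A) : A :=
  CFC.sqrt (innerAt (gen 0) (tangentZero v) (tangentZero v))

/-- The element `(1 + |z|)(1 - |z|)⁻¹`, where `|z| = (z* z)^{1/2}`. -/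
def crCoeff {A : Type*} [CStarAlgebra A] [PartialOrder A] [StarOrderedRing A] (z : A) : A :=
  (1 + CFC.abs z) * Ring.inverse (1 - CFC.abs z)

/-- The cross ratio endomorphism `cr(0, z) : ℓ_z → ℓ_z`,
`(1, z) a ↦ (1, z) (1 + |z|)(1 - |z|)⁻¹ a`. Note that `a` is the first entry of `(1, z) a`. -/
def cr {A : Type*} [CStarAlgebra A] [PartialOrder A] [StarOrderedRing A] (z : A) :
    Module.End Aᵐᵒᵖ (line z) where
  toFun x := ⟨MulOpposite.op (crCoeff z * (x : Fin 2 → A) 0) • gen z,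
    Submodule.smul_mem _ _ (gen_mem_line z)⟩
  map_add' x y := by
    ext i
    simp [mul_add]
  map_smul' b x := by
    ext i
    simp [mul_assoc]

/-- The coefficient `a` of an endomorphism `φ` of `ℓ_0` in the basis `e₁`: `φ(e₁) = e₁ a`. -/
def coeffZero {A : Type*} [CStarAlgebra A] (φ : Module.End Aᵐᵒᵖ (line (0 : A))) : A :=
  (φ ⟨gen 0, gen_mem_line 0⟩ : Fin 2 → A) 0

end

end OperatorDisk

/-! Everything reduces to real functions of one positive element. No polar decomposition is needed:
functions of `|v|` times a phase are written `v * cfc h (star v * v)`, with `h` of the type `f √x /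
√x`. Splitting `exp (hat v)` into even and odd powers (`exp_hat`) gives `expZero v = v * cfc
tanhQuot (star v * v)`, and `alpha` has the same shape with `artanhQuot`. Such an element has
squared modulus `x * h x ^ 2` evaluated at `star v * v` (`star_mul_cfc_mul_self`), so that `expZero`
and `alpha` are mutually inverse by two scalar identities.

The metric at the origin gives `mod₀ v = 2|v|`, whence `mod₀ (Log₀ z) = 2 artanh |z|`, whose
exponential is `(1 + |z|)(1 - |z|)⁻¹`. The transport sends `e₁` to `(1, z) c` with `c = cosh |α|`;
as `c` and the cross ratio coefficient are both functions of `star z * z`, they commute, and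
conjugation by `c` changes nothing. -/

namespace OperatorDisk

/-! ### Real power series -/

/-- The sum of the real power series with coefficients `c`. -/
noncomputable def powerSum (c : ℕ → ℝ) (x : ℝ) : ℝ := ∑' k, c k * x ^ k

theorem powerSum_zero (c : ℕ → ℝ) : powerSum c 0 = c 0 := by
  rw [powerSum, tsum_eq_single 0] <;> simp +contextual

theorem norm_coeff_mul_pow_le (c : ℕ → ℝ) {r x : ℝ} (hx : |x| ≤ r) (k : ℕ) :
    ‖c k * x ^ k‖ ≤ |c k| * r ^ k := by
  rw [norm_mul, norm_pow, Real.norm_eq_abs, Real.norm_eq_abs]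
  gcongr

theorem continuousOn_powerSum {c : ℕ → ℝ} {r : ℝ} (hc : Summable fun k => |c k| * r ^ k) :
    ContinuousOn (powerSum c) (Set.Icc (-r) r) :=
  continuousOn_tsum (fun k => by fun_prop) hc
    fun k _ hx => norm_coeff_mul_pow_le c (abs_le.2 hx) k

/-- The coefficients of `cosh √x`. -/
noncomputable def coshCoeff (k : ℕ) : ℝ := ((2 * k).factorial : ℝ)⁻¹

/-- The coefficients of `sinh √x / √x`. -/
noncomputable def sinhCoeff (k : ℕ) : ℝ := ((2 * k + 1).factorial : ℝ)⁻¹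

/-- The coefficients of `artanh √x / √x`. -/
noncomputable def artanhCoeff (k : ℕ) : ℝ := 1 / (2 * (k : ℝ) + 1)

theorem coshCoeff_pos (k : ℕ) : 0 < coshCoeff k := by unfold coshCoeff; positivity

theorem sinhCoeff_pos (k : ℕ) : 0 < sinhCoeff k := by unfold sinhCoeff; positivity

theorem artanhCoeff_pos (k : ℕ) : 0 < artanhCoeff k := by unfold artanhCoeff; positivity

theorem summable_abs_coshCoeff (r : ℝ) : Summable fun k => |coshCoeff k| * r ^ k := by
  refine Summable.of_norm_bounded (g := fun k => coshCoeff k * |r| ^ k) ?_ fun k => ?_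
  · refine (Real.hasSum_cosh (√|r|)).summable.congr fun k => ?_
    rw [pow_mul, Real.sq_sqrt (abs_nonneg r), coshCoeff, div_eq_inv_mul]
  · simp [abs_of_pos (coshCoeff_pos k)]

theorem summable_abs_sinhCoeff (r : ℝ) : Summable fun k => |sinhCoeff k| * r ^ k := by
  refine Summable.of_norm_bounded (g := fun k => coshCoeff k * |r| ^ k) ?_ fun k => ?_
  · simpa [abs_of_pos (coshCoeff_pos _)] using summable_abs_coshCoeff |r|
  · simp only [norm_mul, norm_pow, Real.norm_eq_abs, abs_of_pos (sinhCoeff_pos k)]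
    gcongr
    unfold sinhCoeff coshCoeff
    gcongr
    omega

theorem summable_abs_artanhCoeff {r : ℝ} (hr : |r| < 1) :
    Summable fun k => |artanhCoeff k| * r ^ k := by
  refine Summable.of_norm_bounded (summable_geometric_of_lt_one (abs_nonneg r) hr) fun k => ?_
  simp only [norm_mul, norm_pow, Real.norm_eq_abs, abs_of_pos (artanhCoeff_pos k)]
  refine mul_le_of_le_one_left (by positivity) ?_
  unfold artanhCoeff
  rw [div_le_one (by positivity)]
  linarith [(Nat.cast_nonneg k : (0 : ℝ) ≤ k)]

theorem continuous_powerSum {c : ℕ → ℝ} (hc : ∀ r : ℝ, Summable fun k => |c k| * r ^ k) :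
    Continuous (powerSum c) :=
  continuous_iff_continuousAt.2 fun x =>
    (continuousOn_powerSum (hc (|x| + 1))).continuousAt
      (Icc_mem_nhds (by linarith [neg_abs_le x]) (by linarith [le_abs_self x]))

theorem continuousOn_powerSum_artanhCoeff :
    ContinuousOn (powerSum artanhCoeff) (Set.Ioo (-1) 1) := by
  intro x hx
  obtain ⟨r, hxr, hr⟩ := exists_between (abs_lt.2 hx)
  refine ((continuousOn_powerSum (r := r) (summable_abs_artanhCoeff ?_)).continuousAt
    (Icc_mem_nhds ?_ ?_)).continuousWithinAt
  · rwa [abs_of_pos ((abs_nonneg x).trans_lt hxr)]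
  · exact (abs_lt.1 hxr).1
  · exact (abs_lt.1 hxr).2

theorem powerSum_coshCoeff {x : ℝ} (hx : 0 ≤ x) : powerSum coshCoeff x = Real.cosh √x := by
  rw [Real.cosh_eq_tsum, powerSum]
  congr 1 with k
  rw [pow_mul, Real.sq_sqrt hx, coshCoeff, div_eq_inv_mul]

theorem sqrt_mul_powerSum_sinhCoeff {x : ℝ} (hx : 0 ≤ x) :
    √x * powerSum sinhCoeff x = Real.sinh √x := by
  rw [Real.sinh_eq_tsum, powerSum, ← tsum_mul_left]
  congr 1 with k
  rw [pow_succ, pow_mul, Real.sq_sqrt hx, sinhCoeff]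
  ring

theorem sqrt_lt_one {x : ℝ} (hx1 : x < 1) : √x < 1 := by
  rw [Real.sqrt_lt' one_pos]; simpa using hx1

theorem sqrt_mul_powerSum_artanhCoeff {x : ℝ} (hx : 0 ≤ x) (hx1 : x < 1) :
    √x * powerSum artanhCoeff x = Real.artanh √x := by
  have h0 := Real.sqrt_nonneg x
  have h1 : √x < 1 := sqrt_lt_one hx1
  have h := (Real.hasSum_log_sub_log_of_abs_lt_one (by rwa [abs_of_nonneg h0])).tsum_eq
  rw [Real.artanh_eq_half_log ⟨by linarith, h1.le⟩, Real.log_div (by linarith) (by linarith), ← h,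
    powerSum, ← tsum_mul_left, ← tsum_mul_left]
  congr 1 with k
  rw [pow_succ, pow_mul, Real.sq_sqrt hx, artanhCoeff]
  ring

/-- The function `tanh √x / √x`. -/
noncomputable def tanhQuot (x : ℝ) : ℝ := powerSum sinhCoeff x / powerSum coshCoeff x

/-- The function `artanh √x / √x`. -/
noncomputable def artanhQuot (x : ℝ) : ℝ := powerSum artanhCoeff x

theorem powerSum_coshCoeff_pos {x : ℝ} (hx : 0 ≤ x) : 0 < powerSum coshCoeff x := by
  rw [powerSum_coshCoeff hx]; exact Real.cosh_pos _

theorem continuousOn_tanhQuot : ContinuousOn tanhQuot (Set.Ici 0) :=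
  (continuous_powerSum summable_abs_sinhCoeff).continuousOn.div
    (continuous_powerSum summable_abs_coshCoeff).continuousOn
    fun _ hx => (powerSum_coshCoeff_pos hx).ne'

theorem tanhQuot_zero : tanhQuot 0 = 1 := by
  simp [tanhQuot, powerSum_zero, sinhCoeff, coshCoeff]

theorem artanhQuot_zero : artanhQuot 0 = 1 := by
  simp [artanhQuot, powerSum_zero, artanhCoeff]

theorem sqrt_mul_tanhQuot {x : ℝ} (hx : 0 ≤ x) : √x * tanhQuot x = Real.tanh √x := by
  rw [tanhQuot, ← mul_div_assoc, sqrt_mul_powerSum_sinhCoeff hx, powerSum_coshCoeff hx,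
    Real.tanh_eq_sinh_div_cosh]

theorem sqrt_mul_artanhQuot {x : ℝ} (hx : 0 ≤ x) (hx1 : x < 1) :
    √x * artanhQuot x = Real.artanh √x :=
  sqrt_mul_powerSum_artanhCoeff hx hx1

/-- The map `x ↦ x * tanhQuot x ^ 2` is how `expZero` acts on squared moduli; on moduli it is
`tanh`. -/
theorem sqrt_mul_tanhQuot_sq {x : ℝ} (hx : 0 ≤ x) :
    √(x * tanhQuot x ^ 2) = Real.tanh √x := by
  rw [← sqrt_mul_tanhQuot hx, Real.sqrt_eq_iff_mul_self_eq (by positivity)]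
  · rw [mul_mul_mul_comm, Real.mul_self_sqrt hx, sq]
  · rw [sqrt_mul_tanhQuot hx, Real.tanh_eq_sinh_div_cosh]
    exact div_nonneg (Real.sinh_nonneg_iff.2 (Real.sqrt_nonneg x)) (Real.cosh_pos _).le

theorem sqrt_mul_artanhQuot_sq {x : ℝ} (hx : 0 ≤ x) (hx1 : x < 1) :
    √(x * artanhQuot x ^ 2) = Real.artanh √x := by
  rw [← sqrt_mul_artanhQuot hx hx1, Real.sqrt_eq_iff_mul_self_eq (by positivity)]
  · rw [mul_mul_mul_comm, Real.mul_self_sqrt hx, sq]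
  · exact mul_nonneg (Real.sqrt_nonneg x)
      (tsum_nonneg fun k => mul_nonneg (artanhCoeff_pos k).le (pow_nonneg hx k))

theorem mul_tanhQuot_sq_mem {x : ℝ} (hx : 0 ≤ x) :
    x * tanhQuot x ^ 2 ∈ Set.Ico (0 : ℝ) 1 := by
  refine ⟨by positivity, ?_⟩
  have h := Real.tanh_lt_one √x
  rw [← sqrt_mul_tanhQuot_sq hx, Real.sqrt_lt' one_pos] at h
  simpa using h

/-- This is `artanh (tanh √x) = √x` divided by `√x`; the point `x = 0`, where division fails, is
separate. -/
theorem tanhQuot_mul_artanhQuot {x : ℝ} (hx : 0 ≤ x) :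
    tanhQuot x * artanhQuot (x * tanhQuot x ^ 2) = 1 := by
  obtain rfl | hpos := hx.eq_or_lt
  · simp [tanhQuot_zero, artanhQuot_zero]
  have h := mul_tanhQuot_sq_mem hx
  have key := sqrt_mul_artanhQuot h.1 h.2
  rw [sqrt_mul_tanhQuot_sq hx, Real.artanh_tanh, ← sqrt_mul_tanhQuot hx, mul_assoc] at key
  exact mul_left_cancel₀ (Real.sqrt_pos.2 hpos).ne' (by rw [key, mul_one])

theorem artanhQuot_mul_tanhQuot {x : ℝ} (hx : 0 ≤ x) (hx1 : x < 1) :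
    artanhQuot x * tanhQuot (x * artanhQuot x ^ 2) = 1 := by
  obtain rfl | hpos := hx.eq_or_lt
  · simp [tanhQuot_zero, artanhQuot_zero]
  have key := sqrt_mul_tanhQuot (x := x * artanhQuot x ^ 2) (by positivity)
  rw [sqrt_mul_artanhQuot_sq hx hx1,
    Real.tanh_artanh ⟨by linarith [Real.sqrt_nonneg x], sqrt_lt_one hx1⟩,
    ← sqrt_mul_artanhQuot hx hx1, mul_assoc] at key
  exact mul_left_cancel₀ (Real.sqrt_pos.2 hpos).ne' (by rw [key, mul_one])

/-! ### Power series in the continuous functional calculus -/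

variable {A : Type*} [CStarAlgebra A]

theorem abs_le_norm_of_mem_spectrum {a : A} {x : ℝ} (hx : x ∈ spectrum ℝ a) : |x| ≤ ‖a‖ := by
  cases subsingleton_or_nontrivial A
  · simp [spectrum.of_subsingleton] at hx
  exact spectrum.norm_le_norm_of_mem hx

/-- The spectrum lies in `[-‖a‖, ‖a‖]`, so the Weierstrass test gives uniform convergence there,
which the functional calculus turns into norm convergence. -/
theorem hasSum_cfc_powerSum {a : A} (ha : IsSelfAdjoint a) {c : ℕ → ℝ}
    (hc : Summable fun k => |c k| * ‖a‖ ^ k) :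
    HasSum (fun k => c k • a ^ k) (cfc (powerSum c) a) := by
  have h := tendsto_cfc_fun (a := a) (tendstoUniformlyOn_tsum hc (s := spectrum ℝ a)
    fun k x hx => norm_coeff_mul_pow_le c (abs_le_norm_of_mem_spectrum hx) k)
    (.of_forall fun t => by fun_prop)
  refine Filter.Tendsto.congr (fun t => ?_) h
  have : (fun x : ℝ => ∑ k ∈ t, c k * x ^ k) = ∑ k ∈ t, fun x => c k * x ^ k := by
    ext x; simp
  rw [this, cfc_sum _ _ _ fun k _ => by fun_prop]
  refine Finset.sum_congr rfl fun k _ => ?_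
  rw [cfc_const_mul .., cfc_pow_id ..]

/-! ### The exponential of `hat v` -/

theorem hat_pow_even (v : A) (k : ℕ) :
    hat v ^ (2 * k) = !![(star v * v) ^ k, 0; 0, (v * star v) ^ k] := by
  induction k with
  | zero => simp [Matrix.one_fin_two]
  | succ k ih =>
    rw [mul_add, mul_one, pow_add, ih, sq, hat]
    simp [pow_succ]

theorem hat_pow_odd (v : A) (k : ℕ) :
    hat v ^ (2 * k + 1) = !![0, (star v * v) ^ k * star v; v * (star v * v) ^ k, 0] := by
  rw [pow_succ', hat_pow_even, hat]
  -- Intertwining makes both off-diagonal entries functions of the same element `star v * v`.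
  have h : star v * (v * star v) ^ k = (star v * v) ^ k * star v := by
    induction k with
    | zero => simp
    | succ k ih => rw [pow_succ, ← mul_assoc, ih, pow_succ]; simp only [mul_assoc]
  simp [h]

/-- The closed form of `exp (hat v)`. -/
theorem exp_hat (v : A) :
    NormedSpace.exp (hat v) =
      !![cfc (powerSum coshCoeff) (star v * v), cfc (powerSum sinhCoeff) (star v * v) * star v;
        v * cfc (powerSum sinhCoeff) (star v * v), cfc (powerSum coshCoeff) (v * star v)] := by
  have hC := hasSum_cfc_powerSum (IsSelfAdjoint.star_mul_self v) (summable_abs_coshCoeff _)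
  have hC' := hasSum_cfc_powerSum (IsSelfAdjoint.mul_star_self v) (summable_abs_coshCoeff _)
  have hS := hasSum_cfc_powerSum (IsSelfAdjoint.star_mul_self v) (summable_abs_sinhCoeff _)
  rw [NormedSpace.exp_eq_tsum ℝ]
  refine HasSum.tsum_eq ?_
  -- Matrices carry the product topology, so convergence is checked entrywise.
  refine Pi.hasSum.2 fun i => Pi.hasSum.2 fun j => ?_
  fin_cases i <;> fin_cases j
  · refine (add_zero (cfc (powerSum coshCoeff) (star v * v))) ▸ HasSum.even_add_odd ?_ ?_
    · simpa [hat_pow_even, coshCoeff] using hC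
    · simp [hat_pow_odd, hasSum_zero]
  · refine (zero_add (cfc (powerSum sinhCoeff) (star v * v) * star v)) ▸ HasSum.even_add_odd ?_ ?_
    · simp [hat_pow_even, hasSum_zero]
    · simpa [hat_pow_odd, sinhCoeff] using hS.mul_right (star v)
  · refine (zero_add (v * cfc (powerSum sinhCoeff) (star v * v))) ▸ HasSum.even_add_odd ?_ ?_
    · simp [hat_pow_even, hasSum_zero]
    · simpa [hat_pow_odd, sinhCoeff] using hS.mul_left v
  · refine (add_zero (cfc (powerSum coshCoeff) (v * star v))) ▸ HasSum.even_add_odd ?_ ?_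
    · simpa [hat_pow_even, coshCoeff] using hC'
    · simp [hat_pow_odd, hasSum_zero]

theorem exp_neg_mul_exp (M : Matrix (Fin 2) (Fin 2) A) :
    NormedSpace.exp (-M) * NormedSpace.exp M = 1 := by
  let _ : NormedAlgebra ℚ A := NormedAlgebra.restrictScalars ℚ ℝ A
  rw [← Matrix.exp_add_of_commute _ _ (Commute.neg_left (Commute.refl M)), neg_add_cancel,
    NormedSpace.exp_zero]

/-! ### The exponential and logarithm of the disk -/

theorem alpha_eq {z : A} (hz : ‖z‖ < 1) : alpha z = z * cfc artanhQuot (star z * z) := by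
  have h : ‖star z * z‖ < 1 := by
    rw [CStarRing.norm_star_mul_self]; nlinarith [norm_nonneg z]
  exact congrArg (z * ·) (hasSum_cfc_powerSum (IsSelfAdjoint.star_mul_self z)
    (summable_abs_artanhCoeff (by rwa [abs_of_nonneg (norm_nonneg _)]))).tsum_eq

theorem star_mul_cfc_mul_self (v : A) {h : ℝ → ℝ}
    (hh : ContinuousOn h (spectrum ℝ (star v * v))) :
    star (v * cfc h (star v * v)) * (v * cfc h (star v * v)) =
      cfc (fun x => x * h x ^ 2) (star v * v) := by
  have hs : IsSelfAdjoint (cfc h (star v * v)) := cfc_predicate h _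
  calc star (v * cfc h (star v * v)) * (v * cfc h (star v * v))
      = cfc h (star v * v) * (star v * v) * cfc h (star v * v) := by
        rw [star_mul, hs.star_eq]; simp only [mul_assoc]
    _ = cfc h (star v * v) * cfc (fun x : ℝ => x) (star v * v) * cfc h (star v * v) := by
        rw [cfc_id' ℝ (star v * v)]
    _ = _ := by
        rw [← cfc_mul .., ← cfc_mul ..]
        congr 1 with x
        ring

theorem lt_one_of_mem_spectrum_star_mul_self {z : A} (hz : ‖z‖ < 1) {x : ℝ}
    (hx : x ∈ spectrum ℝ (star z * z)) : x < 1 := by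
  have h := (le_abs_self x).trans (abs_le_norm_of_mem_spectrum hx)
  rw [CStarRing.norm_star_mul_self] at h
  nlinarith [norm_nonneg z]

/-- Here `θ` equals `1 - t² v*v`, stationary at `t = 0`; the normalisation of the projection thus
adds nothing to the tangent vector. -/
theorem hasDerivAt_inverse_theta_gen (v : A) :
    HasDerivAt (fun t : ℝ => Ring.inverse (theta (gen (t • v)) (gen (t • v)))) 0 0 := by
  have h : HasDerivAt (fun t : ℝ => 1 - (t ^ 2) • (star v * v)) (0 : A) 0 := by
    simpa using ((hasDerivAt_pow 2 (0 : ℝ)).smul_const (star v * v)).const_sub 1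
  have hinv := hasFDerivAt_ringInverse (𝕜 := ℝ) (1 : Aˣ)
  have e : (((1 : Aˣ) : A)) = 1 - ((0 : ℝ) ^ 2) • (star v * v) := by simp
  rw [e] at hinv
  simpa [theta, gen, sq, smul_smul, Function.comp_def] using hinv.comp_hasDerivAt (0 : ℝ) h

theorem tangentZero_mulVec_gen (v : A) : tangentZero v *ᵥ gen 0 = ![0, (2 : ℝ) • v] := by
  have h := hasDerivAt_inverse_theta_gen v
  have h0 : tangentZero v 0 0 = 0 := by
    have := ((h.const_smul (2 : ℝ)).sub_const 1).deriv
    simpa [tangentZero, reflection, thetaProj, gen, theta] using this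
  have h1 : tangentZero v 1 0 = (2 : ℝ) • v := by
    have := ((((hasDerivAt_id (0 : ℝ)).smul_const v).mul h).const_smul (2 : ℝ)).deriv
    simpa [tangentZero, reflection, thetaProj, gen, theta, Pi.mul_def, Pi.smul_def] using this
  ext i
  fin_cases i <;> simp [Matrix.mulVec, dotProduct, gen, h0, h1]

theorem one_sub_sqrt_ne_zero {z : A} (hz : ‖z‖ < 1) :
    ∀ x ∈ spectrum ℝ (star z * z), 1 - √x ≠ 0 := fun _ hx =>
  (sub_pos.2 (sqrt_lt_one (lt_one_of_mem_spectrum_star_mul_self hz hx))).ne'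

variable [PartialOrder A] [StarOrderedRing A]

theorem nonneg_of_mem_spectrum_star_mul_self (v : A) {x : ℝ}
    (hx : x ∈ spectrum ℝ (star v * v)) : 0 ≤ x :=
  spectrum_nonneg_of_nonneg (star_mul_self_nonneg v) hx

theorem continuousOn_tanhQuot_spectrum (v : A) :
    ContinuousOn tanhQuot (spectrum ℝ (star v * v)) :=
  continuousOn_tanhQuot.mono fun _ hx => nonneg_of_mem_spectrum_star_mul_self v hx

theorem continuousOn_artanhQuot_spectrum {z : A} (hz : ‖z‖ < 1) :
    ContinuousOn artanhQuot (spectrum ℝ (star z * z)) :=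
  continuousOn_powerSum_artanhCoeff.mono fun _ hx =>
    ⟨by linarith [nonneg_of_mem_spectrum_star_mul_self z hx],
      lt_one_of_mem_spectrum_star_mul_self hz hx⟩

/-- The `cosh` series is positive on the nonnegative spectrum, so the quotient becomes a genuine
inverse, as in `moebius`. -/
theorem cfc_tanhQuot (v : A) : cfc tanhQuot (star v * v) =
    cfc (powerSum sinhCoeff) (star v * v) *
      Ring.inverse (cfc (powerSum coshCoeff) (star v * v)) := by
  have hS := (continuous_powerSum summable_abs_sinhCoeff).continuousOn
    (s := spectrum ℝ (star v * v))
  have hC := (continuous_powerSum summable_abs_coshCoeff).continuousOn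
    (s := spectrum ℝ (star v * v))
  have h0 : ∀ x ∈ spectrum ℝ (star v * v), powerSum coshCoeff x ≠ 0 := fun x hx =>
    (powerSum_coshCoeff_pos (nonneg_of_mem_spectrum_star_mul_self v hx)).ne'
  rw [← cfc_inv _ _ h0 hC, ← cfc_mul _ (fun x => (powerSum coshCoeff x)⁻¹) _ hS (hC.inv₀ h0)]
  rfl

theorem expZero_eq (v : A) : expZero v = v * cfc tanhQuot (star v * v) := by
  simp [expZero, moebius, exp_hat, cfc_tanhQuot, mul_assoc]

theorem isUnit_cfc_coshCoeff (v : A) : IsUnit (cfc (powerSum coshCoeff) (star v * v)) :=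
  (isUnit_cfc_iff _ _ (continuous_powerSum summable_abs_coshCoeff).continuousOn
    (IsSelfAdjoint.star_mul_self v)).2 fun _ hx =>
      (powerSum_coshCoeff_pos (nonneg_of_mem_spectrum_star_mul_self v hx)).ne'

theorem star_expZero_mul_self (v : A) :
    star (expZero v) * expZero v = cfc (fun x => x * tanhQuot x ^ 2) (star v * v) := by
  rw [expZero_eq, star_mul_cfc_mul_self v (continuousOn_tanhQuot_spectrum v)]

theorem star_alpha_mul_self {z : A} (hz : ‖z‖ < 1) :
    star (alpha z) * alpha z = cfc (fun x => x * artanhQuot x ^ 2) (star z * z) := by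
  rw [alpha_eq hz, star_mul_cfc_mul_self z (continuousOn_artanhQuot_spectrum hz)]

theorem expZero_alpha {z : A} (hz : ‖z‖ < 1) : expZero (alpha z) = z := by
  have hg := continuousOn_artanhQuot_spectrum hz
  have hf : ContinuousOn tanhQuot
      ((fun x => x * artanhQuot x ^ 2) '' spectrum ℝ (star z * z)) := by
    refine continuousOn_tanhQuot.mono ?_
    rintro _ ⟨x, hx, rfl⟩
    exact mul_nonneg (nonneg_of_mem_spectrum_star_mul_self z hx) (sq_nonneg _)
  have hm : ContinuousOn (fun x => x * artanhQuot x ^ 2) (spectrum ℝ (star z * z)) := by fun_prop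
  rw [expZero_eq, star_alpha_mul_self hz, ← cfc_comp' tanhQuot _ _ hf hm, alpha_eq hz, mul_assoc,
    ← cfc_mul _ (fun x => tanhQuot (x * artanhQuot x ^ 2)) _ hg
      (hf.comp hm (Set.mapsTo_image _ _))]
  -- After composing the two calculi, the factor multiplying `z` is the constant `1` on the
  -- spectrum.
  rw [cfc_congr (g := fun _ => (1 : ℝ)) fun x hx => artanhQuot_mul_tanhQuot
    (nonneg_of_mem_spectrum_star_mul_self z hx) (lt_one_of_mem_spectrum_star_mul_self hz hx),
    cfc_const_one .., mul_one]

theorem alpha_expZero {v : A} (hv : ‖expZero v‖ < 1) : alpha (expZero v) = v := by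
  have hf := continuousOn_tanhQuot_spectrum v
  have hg : ContinuousOn artanhQuot
      ((fun x => x * tanhQuot x ^ 2) '' spectrum ℝ (star v * v)) := by
    refine continuousOn_powerSum_artanhCoeff.mono ?_
    rintro _ ⟨x, hx, rfl⟩
    have h := mul_tanhQuot_sq_mem (nonneg_of_mem_spectrum_star_mul_self v hx)
    exact ⟨by linarith [h.1], h.2⟩
  have hm : ContinuousOn (fun x => x * tanhQuot x ^ 2) (spectrum ℝ (star v * v)) := by fun_prop
  rw [alpha_eq hv, star_expZero_mul_self, ← cfc_comp' artanhQuot _ _ hg hm, expZero_eq, mul_assoc,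
    ← cfc_mul _ (fun x => artanhQuot (x * tanhQuot x ^ 2)) _ hf
      (hg.comp hm (Set.mapsTo_image _ _))]
  rw [cfc_congr (g := fun _ => (1 : ℝ)) fun x hx => tanhQuot_mul_artanhQuot
    (nonneg_of_mem_spectrum_star_mul_self v hx), cfc_const_one .., mul_one]

theorem existsUnique_expZero {z : A} (hz : ‖z‖ < 1) : ∃! v : A, expZero v = z := by
  refine ⟨alpha z, expZero_alpha hz, ?_⟩
  rintro v rfl
  exact (alpha_expZero hz).symm

/-- `Function.invFun` chooses some preimage; uniqueness identifies it. -/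
theorem logZero_eq_alpha {z : A} (hz : ‖z‖ < 1) : logZero z = alpha z :=
  (existsUnique_expZero hz).unique
    (Function.invFun_eq (existsUnique_expZero hz).exists) (expZero_alpha hz)

/-! ### The modulus and the cross ratio -/

theorem sqrt_star_mul_self_eq_cfc (v : A) :
    CFC.sqrt (star v * v) = cfc Real.sqrt (star v * v) := by
  refine CFC.sqrt_unique ?_ (cfc_nonneg fun x _ => Real.sqrt_nonneg x)
  rw [← cfc_mul .., cfc_congr (g := fun x => x) fun x hx =>
    Real.mul_self_sqrt (nonneg_of_mem_spectrum_star_mul_self v hx), cfc_id' ..]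

theorem modZero_eq (v : A) : modZero v = cfc (fun x => 2 * √x) (star v * v) := by
  have h : innerAt (gen 0) (tangentZero v) (tangentZero v) =
      star ((2 : ℝ) • v) * ((2 : ℝ) • v) := by
    rw [innerAt, tangentZero_mulVec_gen]
    simp [theta]
  rw [modZero, h]
  refine CFC.sqrt_unique ?_ (cfc_nonneg fun x _ => by positivity)
  rw [← cfc_mul .., cfc_congr (g := fun x => 4 * x) fun x hx => ?_, cfc_const_mul_id ..]
  · simp only [star_smul, star_trivial, smul_mul_smul_comm]
    norm_num
  · have := Real.mul_self_sqrt (nonneg_of_mem_spectrum_star_mul_self v hx)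
    simp only
    linear_combination 4 * this

theorem modZero_logZero {z : A} (hz : ‖z‖ < 1) :
    modZero (logZero z) = cfc (fun x => 2 * Real.artanh √x) (star z * z) := by
  have hg := continuousOn_artanhQuot_spectrum hz
  rw [logZero_eq_alpha hz, modZero_eq, star_alpha_mul_self hz, ← cfc_comp' ..]
  refine cfc_congr fun x hx => ?_
  simp only [sqrt_mul_artanhQuot_sq (nonneg_of_mem_spectrum_star_mul_self z hx)
    (lt_one_of_mem_spectrum_star_mul_self hz hx)]

theorem crCoeff_eq {z : A} (hz : ‖z‖ < 1) :
    crCoeff z = cfc (fun x => (1 + √x) * (1 - √x)⁻¹) (star z * z) := by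
  have h0 := one_sub_sqrt_ne_zero hz
  rw [cfc_mul _ (fun x => (1 - √x)⁻¹) _ (by fun_prop) (ContinuousOn.inv₀ (by fun_prop) h0), cfc_inv _ _ h0,
    cfc_add .., cfc_sub .., cfc_const_one .., crCoeff, CFC.abs, sqrt_star_mul_self_eq_cfc]

theorem exp_modZero_logZero {z : A} (hz : ‖z‖ < 1) :
    NormedSpace.exp (modZero (logZero z)) = crCoeff z := by
  have hcont : ContinuousOn (fun x => 2 * Real.artanh √x) (spectrum ℝ (star z * z)) := by
    have hg := continuousOn_artanhQuot_spectrum hz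
    -- Continuity of `artanh √x` is read off from the power series.
    refine ContinuousOn.congr (f := fun x => 2 * (√x * artanhQuot x)) (by fun_prop) fun x hx => ?_
    simp only [sqrt_mul_artanhQuot (nonneg_of_mem_spectrum_star_mul_self z hx)
      (lt_one_of_mem_spectrum_star_mul_self hz hx)]
  rw [modZero_logZero hz, ← CFC.real_exp_eq_normedSpace_exp (cfc_predicate _ _),
    ← cfc_comp' Real.exp _ _ (by fun_prop) hcont, crCoeff_eq hz]
  refine cfc_congr fun x hx => ?_
  have h1 := sqrt_lt_one (lt_one_of_mem_spectrum_star_mul_self hz hx)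
  have h0 := Real.sqrt_nonneg x
  -- `exp (artanh s)` is the square root of `(1 + s) / (1 - s)`; the factor `2` squares it.
  rw [two_mul, Real.exp_add, Real.exp_artanh ⟨by linarith, h1⟩, Real.mul_self_sqrt, div_eq_mul_inv]
  exact div_nonneg (by linarith) (by linarith)

theorem modZero_logZero_eq_log {z : A} (hz : ‖z‖ < 1) :
    modZero (logZero z) = CFC.log (crCoeff z) := by
  rw [← exp_modZero_logZero hz, CFC.log_exp _ (by rw [modZero_eq]; exact cfc_predicate _ _)]

/-! ### The parallel transport -/

/-- The coefficient of `exp (hat α) e₁` in the basis `(1, z)` of `ℓ_z`. -/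
noncomputable def transportCoeff (z : A) : A :=
  cfc (powerSum coshCoeff) (star (alpha z) * alpha z)

theorem isUnit_transportCoeff (z : A) : IsUnit (transportCoeff z) := isUnit_cfc_coshCoeff _

theorem exp_hat_alpha_mulVec {z : A} (hz : ‖z‖ < 1) (a : A) :
    NormedSpace.exp (hat (alpha z)) *ᵥ ![a, 0] =
      ![transportCoeff z * a, z * (transportCoeff z * a)] := by
  have h : alpha z * cfc (powerSum sinhCoeff) (star (alpha z) * alpha z) =
      z * transportCoeff z := by
    have := expZero_alpha hz
    rw [expZero_eq, cfc_tanhQuot, ← mul_assoc] at this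
    -- The fourth `z` is the free-standing one on the right; the others sit inside `alpha z` and
    -- `transportCoeff z`.
    nth_rw 4 [← this]
    rw [transportCoeff, mul_assoc _ (Ring.inverse _),
      Ring.inverse_mul_cancel _ (isUnit_cfc_coshCoeff _), mul_one]
  rw [exp_hat, h]
  ext i
  fin_cases i <;> simp [transportCoeff, mul_assoc, Matrix.mulVec, dotProduct]

theorem exp_neg_hat_alpha_mulVec {z : A} (hz : ‖z‖ < 1) (a : A) :
    NormedSpace.exp (-hat (alpha z)) *ᵥ ![a, z * a] =
      ![Ring.inverse (transportCoeff z) * a, 0] := by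
  have h := exp_hat_alpha_mulVec hz (Ring.inverse (transportCoeff z) * a)
  rw [← mul_assoc, Ring.mul_inverse_cancel _ (isUnit_transportCoeff z), one_mul] at h
  rw [← h, Matrix.mulVec_mulVec, exp_neg_mul_exp, Matrix.one_mulVec]

/-- Once `star (alpha z) * alpha z` is expressed through `star z * z`, both sides are functions of
that one element. -/
theorem commute_transportCoeff_crCoeff {z : A} (hz : ‖z‖ < 1) :
    Commute (transportCoeff z) (crCoeff z) := by
  have hg := continuousOn_artanhQuot_spectrum hz
  have hC := continuous_powerSum summable_abs_coshCoeff
  rw [transportCoeff, star_alpha_mul_self hz, ← cfc_comp' .., crCoeff_eq hz]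
  exact cfc_commute_cfc _ _ _

/-- The restriction of `exp (hat α)` to a map `ℓ_0 → ℓ_z`. -/
noncomputable def transport {z : A} (hz : ‖z‖ < 1) : line (0 : A) ≃ₗ[Aᵐᵒᵖ] line z where
  toFun x := ⟨NormedSpace.exp (hat (alpha z)) *ᵥ x, by
    obtain ⟨a, ha⟩ := (mem_line_iff _ _).1 x.2
    rw [ha, zero_mul, exp_hat_alpha_mulVec hz]
    exact (mem_line_iff _ _).2 ⟨_, rfl⟩⟩
  invFun y := ⟨NormedSpace.exp (-hat (alpha z)) *ᵥ y, by
    obtain ⟨a, ha⟩ := (mem_line_iff _ _).1 y.2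
    rw [ha, exp_neg_hat_alpha_mulVec hz]
    exact (mem_line_iff _ _).2 ⟨_, by rw [zero_mul]⟩⟩
  map_add' x y := Subtype.ext <| by
    simp only [Submodule.coe_add, Matrix.mulVec_add]
  map_smul' b x := Subtype.ext <| by
    ext i
    fin_cases i <;> simp [mul_assoc]
  left_inv x := Subtype.ext <| by
    simp only [Matrix.mulVec_mulVec, exp_neg_mul_exp, Matrix.one_mulVec]
  right_inv y := Subtype.ext <| by
    have h := exp_neg_mul_exp (-hat (alpha z))
    rw [neg_neg] at h
    simp only [Matrix.mulVec_mulVec, h, Matrix.one_mulVec]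

theorem coe_transport_apply {z : A} (hz : ‖z‖ < 1) (x : line (0 : A)) :
    (transport hz x : Fin 2 → A) = NormedSpace.exp (hat (alpha z)) *ᵥ (x : Fin 2 → A) := by
  rfl

theorem coe_transport_symm_apply {z : A} (hz : ‖z‖ < 1) (y : line z) :
    ((transport hz).symm y : Fin 2 → A) =
      NormedSpace.exp (-hat (alpha z)) *ᵥ (y : Fin 2 → A) := by
  rfl

theorem coeffZero_transport_cr {z : A} (hz : ‖z‖ < 1) :
    coeffZero ((transport hz).symm.toLinearMap ∘ₗ cr z ∘ₗ (transport hz).toLinearMap) =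
      crCoeff z := by
  have h1 : NormedSpace.exp (hat (alpha z)) *ᵥ gen 0 =
      ![transportCoeff z, z * transportCoeff z] := by
    simpa [gen] using exp_hat_alpha_mulVec hz 1
  have h2 : MulOpposite.op (crCoeff z * transportCoeff z) • gen z =
      ![crCoeff z * transportCoeff z, z * (crCoeff z * transportCoeff z)] := by
    ext i
    fin_cases i <;> simp [gen]
  have h3 : ((cr z (transport hz ⟨gen 0, gen_mem_line 0⟩) : line z) : Fin 2 → A) =
      MulOpposite.op (crCoeff z * (NormedSpace.exp (hat (alpha z)) *ᵥ gen 0) 0) • gen z := rfl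
  rw [coeffZero, LinearMap.comp_apply, LinearMap.comp_apply, LinearEquiv.coe_coe,
    LinearEquiv.coe_coe, coe_transport_symm_apply, h3, h1, Matrix.cons_val_zero, h2, exp_neg_hat_alpha_mulVec hz, Matrix.cons_val_zero,
    ← (commute_transportCoeff_crCoeff hz).eq, ← mul_assoc,
    Ring.inverse_mul_cancel _ (isUnit_transportCoeff z), one_mul]

end OperatorDisk

theorem theorem10p1 {A : Type*} [CStarAlgebra A] [PartialOrder A] [StarOrderedRing A]
    (z : A) (hz : ‖z‖ < 1) :
    (∃! v : A, OperatorDisk.expZero v = z) ∧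
    ∃ T : OperatorDisk.line (0 : A) ≃ₗ[Aᵐᵒᵖ] OperatorDisk.line z,
      (∀ x : OperatorDisk.line (0 : A),
        (T x : Fin 2 → A) =
          NormedSpace.exp (OperatorDisk.hat (OperatorDisk.alpha z)) *ᵥ (x : Fin 2 → A)) ∧
      (∀ y : OperatorDisk.line z,
        (T.symm y : Fin 2 → A) =
          NormedSpace.exp (-OperatorDisk.hat (OperatorDisk.alpha z)) *ᵥ (y : Fin 2 → A)) ∧
      NormedSpace.exp (OperatorDisk.modZero (OperatorDisk.logZero z)) =
        OperatorDisk.coeffZero (T.symm.toLinearMap ∘ₗ OperatorDisk.cr z ∘ₗ T.toLinearMap) ∧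
      OperatorDisk.modZero (OperatorDisk.logZero z) =
        CFC.log (OperatorDisk.coeffZero
          (T.symm.toLinearMap ∘ₗ OperatorDisk.cr z ∘ₗ T.toLinearMap)) := by
  refine ⟨OperatorDisk.existsUnique_expZero hz, OperatorDisk.transport hz,
    OperatorDisk.coe_transport_apply hz, OperatorDisk.coe_transport_symm_apply hz, ?_, ?_⟩
  · rw [OperatorDisk.coeffZero_transport_cr, OperatorDisk.exp_modZero_logZero hz]
  · rw [OperatorDisk.coeffZero_transport_cr, OperatorDisk.modZero_logZero_eq_log hz]
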